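/- Let $S\subset\mathbb{R}^3$ be a round 2-sphere (of any center and any radius $r>0$) and let $n\ge 0$. Let $\operatorname{LConf}_n(S)\subset S^n$ be the space of $n$-tuples of pairwise distinct points of $S$ (labeled configurations of $n$ dots), with the subspace topology, and let $\operatorname{Conf}_n(S)=\operatorname{LConf}_n(S)/\Sigma_n$ be its quotient by the symmetric group permuting the labels (unlabeled configurations), with the quotient topology. A configuration is in general position if no four of its dots lie on a common circle, and in semigeneral position if at most one quadruple (4-element subset) of its dots lies on a common circle. Proposition. Let $X$ be either $\operatorname{LConf}_n(S)$ or $\operatorname{Conf}_n(S)$, and let $D,D'\in X$ be configurations in general position. Then there is a continuous path $D(t)$, $t\in[0,1]$, in $X$ with $D(0)=D$ and $D(1)=D'$ such that 1. for all but finitely many $t\in[0,1]$, $D(t)$ is in general position, and 2. for all $t\in[0,1]$, $D(t)$ is in semigeneral position. -/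

import Mathlib

namespace Dots

/-- Euclidean 3-space, in which the round spheres live. -/
abbrev E3 : Type := EuclideanSpace ℝ (Fin 3)

/-- The configuration space of `n` labeled dots in the sphere `S` with center `c` and radius `r`:
the `n`-tuples of pairwise distinct points of `S`, as a subspace of the product `S × ⋯ × S`. -/
abbrev LConf (c : E3) (r : ℝ) (n : ℕ) : Type :=
  {d : Fin n → Metric.sphere c r // ∀ i j, i ≠ j → d i ≠ d j}

/-- Two labeled configurations are related when they differ by a permutation of the labels:
the orbit relation of the symmetric group. -/
def relabel (c : E3) (r : ℝ) (n : ℕ) : Setoid (LConf c r n) where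
  r d e := ∃ σ : Equiv.Perm (Fin n), ∀ i, e.1 i = d.1 (σ i)
  iseqv :=
    { refl := fun _ => ⟨1, fun _ => rfl⟩
      symm := by
        rintro d e ⟨σ, h⟩
        exact ⟨σ.symm, fun i => by rw [h, Equiv.apply_symm_apply]⟩
      trans := by
        rintro d e f ⟨σ, h⟩ ⟨τ, k⟩
        exact ⟨τ.trans σ, fun i => by rw [k, h, Equiv.trans_apply]⟩ }

/-- The configuration space of `n` unlabeled dots in the sphere with center `c` and radius `r`:
the quotient of the labeled configuration space by the symmetric group, with the quotient
topology. -/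
abbrev Conf (c : E3) (r : ℝ) (n : ℕ) : Type := Quotient (relabel c r n)

/-- The set of dots of a labeled configuration. -/
def LConf.dots {c : E3} {r : ℝ} {n : ℕ} (d : LConf c r n) : Set E3 :=
  Set.range fun i => (d.1 i : E3)

theorem LConf.dots_eq_of_relabel {c : E3} {r : ℝ} {n : ℕ} (d e : LConf c r n)
    (h : (relabel c r n).r d e) : LConf.dots d = LConf.dots e := by
  obtain ⟨σ, h⟩ := h
  ext x
  constructor
  · rintro ⟨i, rfl⟩
    exact ⟨σ.symm i, by simp [h]⟩
  · rintro ⟨i, rfl⟩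
    exact ⟨σ i, by simp [h]⟩

/-- The set of dots of an unlabeled configuration. -/
def Conf.dots {c : E3} {r : ℝ} {n : ℕ} (d : Conf c r n) : Set E3 :=
  Quotient.lift LConf.dots LConf.dots_eq_of_relabel d

/-- `Q` is a cocircular quadruple of dots of `D`: four distinct dots lying on a common circle. -/
def CocircularQuadruple (D : Set E3) (Q : Finset E3) : Prop :=
  (Q : Set E3) ⊆ D ∧ Q.card = 4 ∧ EuclideanGeometry.Concyclic (Q : Set E3)

/-- A set of dots in a sphere is in general position if no four dots lie on a circle. -/
def GeneralPosition (D : Set E3) : Prop :=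
  ∀ Q : Finset E3, ¬ CocircularQuadruple D Q

/-- A set of dots in a sphere is in semigeneral position if at most one quadruple of dots is
cocircular. -/
def SemigeneralPosition (D : Set E3) : Prop :=
  ∀ Q Q' : Finset E3, CocircularQuadruple D Q → CocircularQuadruple D Q' → Q = Q'

end Dots

/-! Move one dot `x` at a time, keeping the remaining dots `B` fixed and in general position. A
cocircular quadruple then consists of `x` and a triple of `B` whose plane contains `x`, so two
quadruples at once put `x` on two distinct circles, which happens at only finitely many points
(`finite_doublePoints`). It remains to move `x` from `p` to `q` along an arc that avoids those
points and `B`, and that meets every circle finitely often. Take the circle through `p`, `q` and a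
generic point `o` of the sphere, and its arc missing `o` (`exists_arc`). A forbidden point on the
arc would span, with `p` and `q`, a plane containing `o`, against genericity; a circle through three
dots met three times would contain `p` (`goodJoined_of_forall_ne`). Finally, all dots are replaced
in turn, passing through a third configuration generic with respect to both ends. -/

namespace Dots

open scoped RealInnerProductSpace

/-! ### Planes spanned by points of a sphere -/

/-- A plane through three distinct points of a sphere is spanned by them. -/
theorem affineSpan_eq_of_card_eq_three {c : E3} {r : ℝ} {T : Finset E3}
    (hT : (T : Set E3) ⊆ Metric.sphere c r) (hcard : T.card = 3)
    {P : AffineSubspace ℝ E3} (hP : Module.finrank ℝ P.direction ≤ 2) (hTP : (T : Set E3) ⊆ P) :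
    affineSpan ℝ (T : Set E3) = P := by
  have hind : AffineIndependent ℝ (fun x : (T : Set E3) => (x : E3)) := by
    obtain ⟨x, y, z, hxy, hxz, hyz, rfl⟩ := Finset.card_eq_three.1 hcard
    have hs : EuclideanGeometry.Cospherical ({x, y, z} : Set E3) :=
      ⟨c, r, fun p hp => hT (by simpa using hp)⟩
    have h := (hs.affineIndependent_of_ne hxy hxz hyz).range
    have e : Set.range ![x, y, z] = ((({x, y, z} : Finset E3)) : Set E3) := by
      ext; simp [Set.range, Fin.exists_fin_succ, eq_comm]
    rwa [e] at h
  have hle : affineSpan ℝ (T : Set E3) ≤ P := affineSpan_le.2 hTP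
  have hfr : Module.finrank ℝ (vectorSpan ℝ (T : Set E3)) = 2 := by
    have := hind.finrank_vectorSpan (n := 2) (by simp [hcard])
    rwa [Subtype.range_coe] at this
  refine AffineSubspace.eq_of_direction_eq_of_nonempty_of_le ?_ ?_ hle
  · refine Submodule.eq_of_le_of_finrank_le (AffineSubspace.direction_le hle) ?_
    rw [direction_affineSpan, hfr]; exact hP
  · have : T.Nonempty := Finset.card_pos.1 (by omega)
    exact (affineSpan_nonempty ℝ).2 (by simpa using this)

theorem finrank_direction_affineSpan_le_two {T : Finset E3} (hcard : T.card ≤ 3) :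
    Module.finrank ℝ (affineSpan ℝ (T : Set E3)).direction ≤ 2 := by
  rw [direction_affineSpan]
  rcases T.eq_empty_or_nonempty with rfl | h
  · rw [Finset.coe_empty, vectorSpan_empty, finrank_bot]; omega
  · have hp := Finset.card_pos.2 h
    have := finrank_vectorSpan_image_finset_le ℝ (id : E3 → E3) T (n := T.card - 1) (by omega)
    rw [Finset.image_id] at this
    omega

theorem affineSpan_ne_top {T : Finset E3} (hcard : T.card ≤ 3) :
    affineSpan ℝ (T : Set E3) ≠ ⊤ := by
  intro h
  have := finrank_direction_affineSpan_le_two hcard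
  rw [h, AffineSubspace.direction_top, finrank_top] at this
  simp at this

/-! ### Generic points of a sphere -/

/-- A curve on a sphere that meets each plane finitely often. -/
noncomputable def sphereCurve (c : E3) (r a : ℝ) : E3 :=
  -- Inverse stereographic projection of the plane cubic `(a, a ^ 3)`.
  c + (r / (1 + a ^ 2 + a ^ 6)) • !₂[2 * a, 2 * a ^ 3, a ^ 2 + a ^ 6 - 1]

theorem sphereCurve_mem (c : E3) {r : ℝ} (hr : 0 < r) (a : ℝ) :
    sphereCurve c r a ∈ Metric.sphere c r := by
  have h : (0 : ℝ) < 1 + a ^ 2 + a ^ 6 := by positivity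
  have hn : ‖(!₂[2 * a, 2 * a ^ 3, a ^ 2 + a ^ 6 - 1] : E3)‖ = 1 + a ^ 2 + a ^ 6 := by
    rw [EuclideanSpace.norm_eq, Real.sqrt_eq_iff_mul_self_eq_of_pos h]
    simp [Fin.sum_univ_three]
    ring
  rw [mem_sphere_iff_norm, sphereCurve, add_sub_cancel_left, norm_smul, hn, Real.norm_eq_abs,
    abs_of_pos (by positivity), div_mul_cancel₀ _ h.ne']

/-- Clearing denominators in the equation of a plane containing `P` gives a polynomial in `a`. It is
nonzero because `1`, `a`, `a ^ 3` and `a ^ 2 + a ^ 6` are linearly independent. -/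
theorem finite_sphereCurve_mem (c : E3) {r : ℝ} (hr : 0 < r) {P : AffineSubspace ℝ E3}
    (hP : P ≠ ⊤) : {a : ℝ | sphereCurve c r a ∈ P}.Finite := by
  rcases Set.eq_empty_or_nonempty {a : ℝ | sphereCurve c r a ∈ P} with h | ⟨a₀, ha₀⟩
  · rw [h]; exact Set.finite_empty
  have hdir : P.direction ≠ ⊤ := fun h =>
    hP ((AffineSubspace.direction_eq_top_iff_of_nonempty ⟨_, ha₀⟩).1 h)
  obtain ⟨v, hv, hv0⟩ := Submodule.exists_mem_ne_zero_of_ne_bot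
    (mt Submodule.orthogonal_eq_bot_iff.1 hdir)
  set δ : ℝ := ⟪v, sphereCurve c r a₀ - c⟫ / r with hδ
  let p : Polynomial ℝ := Polynomial.C (v 2 - δ) * Polynomial.X ^ 6
    + Polynomial.C (2 * v 1) * Polynomial.X ^ 3 + Polynomial.C (v 2 - δ) * Polynomial.X ^ 2
    + Polynomial.C (2 * v 0) * Polynomial.X - Polynomial.C (v 2 + δ)
  have hp : p ≠ 0 := by
    intro h0
    have h (k : ℕ) : p.coeff k = 0 := by rw [h0]; simp
    have c0 := h 0
    have c1 := h 1
    have c3 := h 3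
    have c6 := h 6
    simp only [p, Polynomial.coeff_add, Polynomial.coeff_sub, Polynomial.coeff_C_mul,
      Polynomial.coeff_X, Polynomial.coeff_C, Polynomial.coeff_X_pow] at c0 c1 c3 c6
    norm_num at c0 c1 c3 c6
    apply hv0
    ext i
    fin_cases i
    · simpa using c1
    · simpa using c3
    · show v 2 = 0
      linarith
  refine (p.rootSet_finite ℝ).subset fun a ha => ?_
  rw [Polynomial.mem_rootSet]
  refine ⟨hp, ?_⟩
  have h1 : ⟪v, sphereCurve c r a - c⟫ = ⟪v, sphereCurve c r a₀ - c⟫ := by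
    have := (Submodule.mem_orthogonal' _ _).1 hv _ (AffineSubspace.vsub_mem_direction ha ha₀)
    rw [vsub_eq_sub, ← sub_sub_sub_cancel_right _ _ c, inner_sub_right] at this
    linarith
  have h : (0 : ℝ) < 1 + a ^ 2 + a ^ 6 := by positivity
  have h2 : ⟪v, sphereCurve c r a - c⟫ = δ * r := by rw [h1, hδ]; field_simp
  rw [sphereCurve, add_sub_cancel_left, inner_smul_right] at h2
  simp only [PiLp.inner_apply, Fin.sum_univ_three] at h2
  simp at h2
  field_simp at h2
  simp [p]
  linarith

theorem exists_mem_sphere_notMem (c : E3) {r : ℝ} (hr : 0 < r) {F : Set (AffineSubspace ℝ E3)}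
    (hfin : F.Finite) (hF : ∀ P ∈ F, P ≠ ⊤) :
    ∃ o ∈ Metric.sphere c r, ∀ P ∈ F, o ∉ P := by
  have := hfin.biUnion fun P hP => finite_sphereCurve_mem c hr (hF P hP)
  obtain ⟨a, ha⟩ := this.exists_notMem
  refine ⟨_, sphereCurve_mem c hr a, fun P hP h => ha ?_⟩
  exact Set.mem_biUnion hP h

theorem finite_finset_subset {α : Type*} {B : Set α} (hB : B.Finite) :
    {T : Finset α | (T : Set α) ⊆ B}.Finite := by
  refine (hB.toFinset.powerset : Set (Finset α)).toFinite.subset fun T hT => ?_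
  simpa [Finset.subset_iff] using hT

/-- There is a point of the sphere on no point, line or plane spanned by at most three points
of a given finite set. -/
theorem exists_generic (c : E3) {r : ℝ} (hr : 0 < r) {A : Set E3} (hA : A.Finite) :
    ∃ o ∈ Metric.sphere c r, ∀ T : Finset E3, (T : Set E3) ⊆ A → T.card ≤ 3 →
      o ∉ affineSpan ℝ (T : Set E3) := by
  obtain ⟨o, ho, h⟩ := exists_mem_sphere_notMem c hr
    (F := (fun T : Finset E3 => affineSpan ℝ (T : Set E3)) ''
      {T | (T : Set E3) ⊆ A ∧ T.card ≤ 3})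
    (((finite_finset_subset hA).subset fun T hT => hT.1).image _)
    (by rintro _ ⟨T, hT, rfl⟩; exact affineSpan_ne_top hT.2)
  exact ⟨o, ho, fun T hT hc => h _ ⟨T, ⟨hT, hc⟩, rfl⟩⟩

theorem notMem_of_generic {A : Set E3} {o : E3} (h : ∀ T : Finset E3, (T : Set E3) ⊆ A →
    T.card ≤ 3 → o ∉ affineSpan ℝ (T : Set E3)) : o ∉ A := fun ho =>
  h {o} (by simpa using ho) (by simp) (mem_affineSpan ℝ (by simp))

/-! ### Circular arcs by inversion -/

/-- The arc from `p` to `q` of the circle through `o`, `p` and `q` which avoids `o`. -/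
theorem exists_arc {c : E3} {r : ℝ} (p q : Metric.sphere c r) {o : E3}
    (ho : o ∈ Metric.sphere c r) (hp : (p : E3) ≠ o) (hq : (q : E3) ≠ o) (hpq : p ≠ q) :
    ∃ γ : Path p q, Function.Injective γ ∧ ∀ t, (γ t : E3) ≠ o ∧
      (γ t : E3) ∈ affineSpan ℝ {o, (p : E3), (q : E3)} := by
  let I : E3 → E3 := EuclideanGeometry.inversion o 1
  have hI (x : E3) : I x = o + (‖x - o‖ ^ 2)⁻¹ • (x - o) := by
    simp [I, EuclideanGeometry.inversion, dist_eq_norm, add_comm]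
  have hII (x : E3) : I (I x) = x := EuclideanGeometry.inversion_inversion o one_ne_zero x
  -- Inversion at `o` turns the sphere minus `o` into a plane missing `o`: expand `‖x - c‖ ^ 2`
  -- around `o` and divide by `‖x - o‖ ^ 2`.
  have hsph (x : E3) (hx : x ≠ o) : x ∈ Metric.sphere c r ↔ 1 + 2 * ⟪I x - o, o - c⟫ = 0 := by
    have hx' : ‖x - o‖ ≠ 0 := by simpa [sub_eq_zero] using hx
    have e : ‖x - c‖ ^ 2 = ‖x - o‖ ^ 2 + 2 * ⟪x - o, o - c⟫ + ‖o - c‖ ^ 2 := by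
      rw [← norm_add_sq_real, sub_add_sub_cancel]
    rw [mem_sphere_iff_norm] at ho
    rw [mem_sphere_iff_norm, hI, add_sub_cancel_left, real_inner_smul_left,
      ← ho, ← sq_eq_sq₀ (norm_nonneg _) (norm_nonneg _), e]
    constructor
    · intro h; field_simp; linarith
    · intro h; field_simp at h; linarith
  -- The arc is the inverse image of a straight segment in that plane.
  let w : ℝ → E3 := fun t => AffineMap.lineMap (I p) (I q) t
  have hw (t : ℝ) : 1 + 2 * ⟪w t - o, o - c⟫ = 0 := by
    have h1 := (hsph p hp).1 p.2
    have h2 := (hsph q hq).1 q.2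
    have : w t - o = (1 - t) • (I p - o) + t • (I q - o) := by
      simp only [w, AffineMap.lineMap_apply_module]; module
    rw [this, inner_add_left, real_inner_smul_left, real_inner_smul_left]
    linear_combination (1 - t) * h1 + t * h2
  have hwo (t : ℝ) : w t ≠ o := by
    intro h; have := hw t; rw [h] at this; simp at this
  have hIwo (t : ℝ) : I (w t) ≠ o := by
    simpa [I, EuclideanGeometry.inversion_eq_center] using hwo t
  have hws (t : ℝ) : I (w t) ∈ Metric.sphere c r := by
    rw [hsph _ (hIwo t), hII]; exact hw t
  have hcont : Continuous fun t => I (w t) := by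
    have hwc : Continuous w := AffineMap.lineMap_continuous
    have hwc' : Continuous fun t => w t - o := hwc.sub continuous_const
    simp only [hI]
    refine continuous_const.add (Continuous.smul (Continuous.inv₀ (hwc'.norm.pow 2) fun t => ?_)
      hwc')
    simpa [sub_eq_zero] using hwo t
  refine ⟨⟨⟨fun t => ⟨I (w t), hws t⟩, ?_⟩, ?_, ?_⟩, ?_, ?_⟩
  · exact Continuous.subtype_mk (hcont.comp continuous_subtype_val) _
  · apply Subtype.ext; simp [w, hII]
  · apply Subtype.ext; simp [w, hII]
  · intro s t h
    have h1 : I (w s) = I (w t) := congrArg Subtype.val h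
    have h2 : w s = w t := by rw [← hII (w s), h1, hII]
    have hne : I (p : E3) ≠ I q := fun h => hpq (Subtype.ext (by rw [← hII p, h, hII]))
    exact Subtype.ext (AffineMap.lineMap_injective ℝ hne h2)
  · refine fun t => ⟨hIwo t, ?_⟩
    show I (w t) ∈ _
    have hline (x y : E3) (s : ℝ) {P : AffineSubspace ℝ E3} (hx : x ∈ P) (hy : y ∈ P) :
        x + s • (y - x) ∈ P := by
      have := AffineMap.lineMap_mem s hx hy
      rwa [AffineMap.lineMap_apply, vsub_eq_sub, vadd_eq_add, add_comm] at this
    have hoP : o ∈ affineSpan ℝ {o, (p : E3), (q : E3)} := mem_affineSpan ℝ (by simp)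
    have hIp : I p ∈ affineSpan ℝ {o, (p : E3), (q : E3)} := by
      rw [hI]; exact hline _ _ _ hoP (mem_affineSpan ℝ (by simp))
    have hIq : I q ∈ affineSpan ℝ {o, (p : E3), (q : E3)} := by
      rw [hI]; exact hline _ _ _ hoP (mem_affineSpan ℝ (by simp))
    rw [hI]
    exact hline _ _ _ hoP (AffineMap.lineMap_mem _ hIp hIq)

/-! ### Cocircular quadruples containing a given dot -/

theorem mem_affineSpan_erase [DecidableEq E3] {c : E3} {r : ℝ} {Q : Finset E3}
    (hQ : (Q : Set E3) ⊆ Metric.sphere c r) (hcard : Q.card = 4)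
    (hcop : Coplanar ℝ (Q : Set E3)) {x : E3} (hx : x ∈ Q) :
    x ∈ affineSpan ℝ ((Q.erase x : Finset E3) : Set E3) := by
  have hsub : ((Q.erase x : Finset E3) : Set E3) ⊆ Q := by simp
  rw [affineSpan_eq_of_card_eq_three (hsub.trans hQ) (by rw [Finset.card_erase_of_mem hx, hcard])
    (P := affineSpan ℝ (Q : Set E3)) ?_ (hsub.trans (subset_affineSpan ℝ _))]
  · exact mem_affineSpan ℝ hx
  · rw [direction_affineSpan]; exact coplanar_iff_finrank_le_two.1 hcop

theorem concyclic_insert [DecidableEq E3] {c : E3} {r : ℝ} {T : Finset E3} {y : E3}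
    (hT : (T : Set E3) ⊆ Metric.sphere c r) (hy : y ∈ Metric.sphere c r) (hcard : T.card = 3)
    (hyT : y ∈ affineSpan ℝ (T : Set E3)) :
    EuclideanGeometry.Concyclic ((insert y T : Finset E3) : Set E3) := by
  rw [Finset.coe_insert]
  refine ⟨⟨c, r, fun p hp => (Set.insert_subset hy hT) hp⟩, ?_⟩
  rw [coplanar_insert_iff_of_mem_affineSpan hyT, coplanar_iff_finrank_le_two,
    ← direction_affineSpan]
  exact finrank_direction_affineSpan_le_two hcard.le

theorem GeneralPosition.mono {A B : Set E3} (hB : GeneralPosition B) (h : A ⊆ B) :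
    GeneralPosition A := fun Q hQ => hB Q ⟨hQ.1.trans h, hQ.2⟩

theorem GeneralPosition.semigeneralPosition {A : Set E3} (hA : GeneralPosition A) :
    SemigeneralPosition A := fun Q _ hQ => (hA Q hQ).elim

theorem GeneralPosition.notMem_affineSpan {c : E3} {r : ℝ} {A : Set E3} (hA : GeneralPosition A)
    (hs : A ⊆ Metric.sphere c r) {T : Finset E3} (hT : (T : Set E3) ⊆ A) (hcard : T.card = 3)
    {y : E3} (hy : y ∈ A) (hyT : y ∉ T) : y ∉ affineSpan ℝ (T : Set E3) := by
  classical
  intro h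
  refine hA (insert y T) ⟨?_, by rw [Finset.card_insert_of_notMem hyT, hcard],
    concyclic_insert (hT.trans hs) (hs hy) hcard h⟩
  rw [Finset.coe_insert]
  exact Set.insert_subset hy hT

/-- A point of `T'` outside `T` would be a fourth dot on the circle of `T`. -/
theorem GeneralPosition.eq_of_affineSpan_eq {c : E3} {r : ℝ} {A : Set E3}
    (hA : GeneralPosition A) (hs : A ⊆ Metric.sphere c r) {T T' : Finset E3}
    (hT : (T : Set E3) ⊆ A) (hcard : T.card = 3) (hT' : (T' : Set E3) ⊆ A) (hcard' : T'.card = 3)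
    (h : affineSpan ℝ (T : Set E3) = affineSpan ℝ (T' : Set E3)) : T = T' := by
  refine (Finset.eq_of_subset_of_card_le (fun y hy => ?_) (by omega)).symm
  by_contra hyT
  refine hA.notMem_affineSpan hs hT hcard (hT' hy) hyT ?_
  rw [h]
  exact mem_affineSpan ℝ hy

/-- A cocircular quadruple created by adding `x` to points in general position consists of `x`
and of three points whose plane contains `x`. -/
theorem CocircularQuadruple.of_insert [DecidableEq E3] {c : E3} {r : ℝ} {B : Set E3}
    (hB : GeneralPosition B) (hs : B ⊆ Metric.sphere c r) {x : E3} (hx : x ∈ Metric.sphere c r)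
    {Q : Finset E3} (hQ : CocircularQuadruple (insert x B) Q) :
    x ∈ Q ∧ ((Q.erase x : Finset E3) : Set E3) ⊆ B ∧ (Q.erase x).card = 3 ∧
      x ∈ affineSpan ℝ ((Q.erase x : Finset E3) : Set E3) := by
  have hxQ : x ∈ Q := by
    by_contra hxQ
    refine hB Q ⟨fun y hy => (hQ.1 hy).resolve_left ?_, hQ.2⟩
    rintro rfl
    exact hxQ hy
  refine ⟨hxQ, fun y hy => ?_, by rw [Finset.card_erase_of_mem hxQ, hQ.2.1],
    mem_affineSpan_erase (hQ.1.trans (Set.insert_subset hx hs)) hQ.2.1 hQ.2.2.2 hxQ⟩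
  rw [Finset.mem_coe, Finset.mem_erase] at hy
  exact (hQ.1 hy.2).resolve_left hy.1

theorem GeneralPosition.insert {c : E3} {r : ℝ} {B : Set E3}
    (hB : GeneralPosition B) (hs : B ⊆ Metric.sphere c r) {x : E3} (hx : x ∈ Metric.sphere c r)
    (h : ∀ T : Finset E3, (T : Set E3) ⊆ B → T.card = 3 → x ∉ affineSpan ℝ (T : Set E3)) :
    GeneralPosition (insert x B) := by
  classical
  intro Q hQ
  obtain ⟨-, h1, h2, h3⟩ := hQ.of_insert hB hs hx
  exact h _ h1 h2 h3

/-- The points of the sphere on two different circles through triples of points of `B`. -/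
def doublePoints (c : E3) (r : ℝ) (B : Set E3) : Set E3 :=
  {x | x ∈ Metric.sphere c r ∧ ∃ T T' : Finset E3, (T : Set E3) ⊆ B ∧ (T' : Set E3) ⊆ B ∧
    T.card = 3 ∧ T'.card = 3 ∧ affineSpan ℝ (T : Set E3) ≠ affineSpan ℝ (T' : Set E3) ∧
    x ∈ affineSpan ℝ (T : Set E3) ∧ x ∈ affineSpan ℝ (T' : Set E3)}

/-- Three points of the sphere determine their plane, so two distinct planes share at most two of
its points; there are finitely many pairs of triples. -/
theorem finite_doublePoints (c : E3) (r : ℝ) {B : Set E3} (hB : B.Finite) :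
    (doublePoints c r B).Finite := by
  have hfin := finite_finset_subset hB
  have : doublePoints c r B ⊆ ⋃ T ∈ {T : Finset E3 | (T : Set E3) ⊆ B},
      ⋃ T' ∈ {T : Finset E3 | (T : Set E3) ⊆ B}, {x | x ∈ Metric.sphere c r ∧
        T.card = 3 ∧ T'.card = 3 ∧ affineSpan ℝ (T : Set E3) ≠ affineSpan ℝ (T' : Set E3) ∧
        x ∈ affineSpan ℝ (T : Set E3) ∧ x ∈ affineSpan ℝ (T' : Set E3)} := by
    rintro x ⟨hx, T, T', hT, hT', h⟩
    exact Set.mem_biUnion hT (Set.mem_biUnion hT' ⟨hx, h⟩)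
  refine (hfin.biUnion fun T _ => hfin.biUnion fun T' _ => ?_).subset this
  by_contra hinf
  obtain ⟨S, hS, hS3⟩ := Set.Infinite.exists_subset_card_eq hinf 3
  have hne : S.Nonempty := Finset.card_pos.1 (by omega)
  obtain ⟨x, hx⟩ := hne
  obtain ⟨-, h1, h2, h3, -⟩ := hS hx
  have hSs : (S : Set E3) ⊆ Metric.sphere c r := fun y hy => (hS hy).1
  apply h3
  rw [← affineSpan_eq_of_card_eq_three hSs hS3 (finrank_direction_affineSpan_le_two h1.le)
      fun y hy => (hS hy).2.2.2.2.1,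
    ← affineSpan_eq_of_card_eq_three hSs hS3 (finrank_direction_affineSpan_le_two h2.le)
      fun y hy => (hS hy).2.2.2.2.2]

theorem GeneralPosition.semigeneralPosition_insert {c : E3} {r : ℝ} {B : Set E3}
    (hB : GeneralPosition B) (hs : B ⊆ Metric.sphere c r) {x : E3} (hx : x ∈ Metric.sphere c r)
    (h : x ∉ doublePoints c r B) : SemigeneralPosition (Insert.insert x B) := by
  classical
  intro Q Q' hQ hQ'
  obtain ⟨h0, h1, h2, h3⟩ := hQ.of_insert hB hs hx
  obtain ⟨k0, k1, k2, k3⟩ := hQ'.of_insert hB hs hx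
  have : Q.erase x = Q'.erase x := by
    refine hB.eq_of_affineSpan_eq hs h1 h2 k1 k2 ?_
    by_contra hne
    exact h ⟨hx, _, _, h1, k1, h2, k2, hne, h3, k3⟩
  rw [← Finset.insert_erase h0, this, Finset.insert_erase k0]

/-- Applied to the endpoints of the arc, which lie on no circle through three other dots. -/
theorem GeneralPosition.notMem_doublePoints {c : E3} {r : ℝ} {B : Set E3} {x : E3}
    (hB : GeneralPosition (Insert.insert x B)) (hs : B ⊆ Metric.sphere c r) (hxB : x ∉ B) :
    x ∉ doublePoints c r B := by
  rintro ⟨hx, T, -, hT, -, hcard, -, -, hxT, -⟩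
  exact hB.notMem_affineSpan (Set.insert_subset hx hs) (hT.trans (Set.subset_insert _ _)) hcard
    (Set.mem_insert _ _) (fun h => hxB (hT h)) hxT

/-! ### Paths moving a single dot -/

/-- Two labeled configurations are joined by a path through configurations in semigeneral
position, all but finitely many of which are in general position. -/
def GoodJoined {c : E3} {r : ℝ} {n : ℕ} (D D' : LConf c r n) : Prop :=
  ∃ γ : Path D D', {t : unitInterval | ¬ GeneralPosition (LConf.dots (γ t))}.Finite ∧
    ∀ t : unitInterval, SemigeneralPosition (LConf.dots (γ t))

section
variable {c : E3} {r : ℝ} {n : ℕ}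

theorem GoodJoined.refl {D : LConf c r n} (hD : GeneralPosition D.dots) : GoodJoined D D :=
  ⟨Path.refl D, by simp [hD], fun _ => hD.semigeneralPosition⟩

theorem GoodJoined.symm {D D' : LConf c r n} (h : GoodJoined D D') : GoodJoined D' D := by
  obtain ⟨γ, h1, h2⟩ := h
  exact ⟨γ.symm, h1.preimage unitInterval.symm_bijective.injective.injOn, fun t => h2 _⟩

theorem GoodJoined.trans {D D' D'' : LConf c r n} (h : GoodJoined D D') (h' : GoodJoined D' D'') :
    GoodJoined D D'' := by
  obtain ⟨γ, h1, h2⟩ := h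
  obtain ⟨δ, k1, k2⟩ := h'
  refine ⟨γ.trans δ, ?_, fun t => ?_⟩
  -- The exceptional times of the concatenation are the numbers `s / 2` and `(s + 1) / 2`, compared
  -- inside `ℝ`.
  · refine Set.Finite.of_finite_image
      (((h1.image fun s : unitInterval => (s : ℝ) / 2).union
        (k1.image fun s : unitInterval => ((s : ℝ) + 1) / 2)).subset ?_)
      Subtype.val_injective.injOn
    rintro _ ⟨t, ht, rfl⟩
    rw [Set.mem_ofPred_eq, Path.trans_apply] at ht
    split_ifs at ht with h
    · exact Or.inl ⟨_, ht, by simp⟩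
    · exact Or.inr ⟨_, ht, by simp⟩
  · rw [Path.trans_apply]
    split_ifs with h
    · exact h2 _
    · exact k2 _

theorem LConf.dots_subset_sphere (D : LConf c r n) : D.dots ⊆ Metric.sphere c r := by
  rintro _ ⟨i, rfl⟩
  exact (D.1 i).2

theorem LConf.finite_dots (D : LConf c r n) : D.dots.Finite := Set.finite_range _

/-- The dots of a configuration other than the `i`-th one. -/
def LConf.others (D : LConf c r n) (i : Fin n) : Set E3 := (fun j => (D.1 j : E3)) '' {i}ᶜ

theorem LConf.dots_eq_insert (D D' : LConf c r n) (i : Fin n)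
    (h : ∀ j, j ≠ i → D'.1 j = D.1 j) : D'.dots = insert (D'.1 i : E3) (D.others i) := by
  ext x
  constructor
  · rintro ⟨j, rfl⟩
    by_cases hj : j = i
    · subst hj; exact Set.mem_insert _ _
    · exact Set.mem_insert_of_mem _ ⟨j, hj, by simp only [h j hj]⟩
  · rintro (rfl | ⟨j, hj, rfl⟩)
    · exact ⟨i, rfl⟩
    · exact ⟨j, by simp only [h j hj]⟩

theorem LConf.notMem_others (D D' : LConf c r n) (i : Fin n)
    (h : ∀ j, j ≠ i → D'.1 j = D.1 j) : (D'.1 i : E3) ∉ D.others i := by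
  rintro ⟨j, hj, e⟩
  simp only [← h j hj] at e
  exact D'.2 j i hj (Subtype.ext e)

/-- Configurations in general position which differ in one dot only are joined. -/
theorem goodJoined_of_forall_ne (hr : 0 < r) (D D' : LConf c r n) (i : Fin n)
    (h : ∀ j, j ≠ i → D'.1 j = D.1 j) (hD : GeneralPosition D.dots)
    (hD' : GeneralPosition D'.dots) : GoodJoined D D' := by
  classical
  set B := D.others i with hBdef
  set p := D.1 i with hp
  set q := D'.1 i with hq
  have hBD : B ⊆ D.dots := by rintro _ ⟨j, -, rfl⟩; exact ⟨j, rfl⟩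
  have hB : GeneralPosition B := hD.mono hBD
  have hBs : B ⊆ Metric.sphere c r := hBD.trans D.dots_subset_sphere
  have hBfin : B.Finite := D.finite_dots.subset hBD
  have hpB : (p : E3) ∉ B := D.notMem_others D i fun _ _ => rfl
  have hqB : (q : E3) ∉ B := D.notMem_others D' i h
  rw [D.dots_eq_insert D i fun _ _ => rfl] at hD
  rw [D.dots_eq_insert D' i h] at hD'
  by_cases hpq : p = q
  · have : D' = D := by
      refine Subtype.ext (funext fun j => ?_)
      by_cases hj : j = i
      · subst hj; exact hpq.symm
      · exact h j hj
    rw [this]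
    refine GoodJoined.refl ?_
    rwa [D.dots_eq_insert D i fun _ _ => rfl]
  have hpF := hD.notMem_doublePoints hBs hpB
  have hqF := hD'.notMem_doublePoints hBs hqB
  set F := doublePoints c r B
  obtain ⟨o, ho, hgen⟩ := exists_generic c hr
    (A := insert (p : E3) (insert (q : E3) (B ∪ F)))
    (((hBfin.union (finite_doublePoints c r hBfin)).insert _).insert _)
  have hoA := notMem_of_generic hgen
  have hpo : (p : E3) ≠ o := by rintro rfl; exact hoA (by simp)
  have hqo : (q : E3) ≠ o := by rintro e; exact hoA (by simp [e])
  have hpq' : (p : E3) ≠ q := fun e => hpq (Subtype.ext e)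
  obtain ⟨γ, hinj, hγ⟩ := exists_arc p q ho hpo hqo hpq
  have hcard : ({o, (p : E3), (q : E3)} : Finset E3).card = 3 :=
    Finset.card_eq_three.2 ⟨_, _, _, hpo.symm, hqo.symm, hpq', rfl⟩
  have hplane (t) : (γ t : E3) ∈ affineSpan ℝ (({o, (p : E3), (q : E3)} : Finset E3) : Set E3) := by
    simpa using (hγ t).2
  have hfr := finrank_direction_affineSpan_le_two hcard.le
  have hmem (x : E3) (hx : x ∈ ({o, (p : E3), (q : E3)} : Finset E3)) :
      x ∈ affineSpan ℝ (({o, (p : E3), (q : E3)} : Finset E3) : Set E3) := mem_affineSpan ℝ hx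
  -- The arc avoids the other dots and the double points.
  have havoid (t) : (γ t : E3) ∉ B ∪ F := by
    intro ht
    have hpt : (p : E3) ≠ γ t := by
      rintro e; rw [← e] at ht; exact ht.elim hpB hpF
    have hqt : (q : E3) ≠ γ t := by
      rintro e; rw [← e] at ht; exact ht.elim hqB hqF
    have hc3 : ({(p : E3), (q : E3), (γ t : E3)} : Finset E3).card = 3 :=
      Finset.card_eq_three.2 ⟨_, _, _, hpq', hpt, hqt, rfl⟩
    -- These three points of the sphere span the plane of the arc, which contains `o`.
    refine hgen {(p : E3), (q : E3), (γ t : E3)} ?_ hc3.le ?_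
    · intro x hx
      simp only [Finset.coe_insert, Finset.coe_singleton, Set.mem_insert_iff,
        Set.mem_singleton_iff] at hx
      rcases hx with rfl | rfl | rfl
      · simp
      · simp
      · exact Or.inr (Or.inr ht)
    · rw [affineSpan_eq_of_card_eq_three (c := c) (r := r) ?_ hc3 hfr ?_]
      · exact hmem _ (by simp)
      · intro x hx
        simp only [Finset.coe_insert, Finset.coe_singleton, Set.mem_insert_iff,
          Set.mem_singleton_iff] at hx
        rcases hx with rfl | rfl | rfl
        exacts [p.2, q.2, (γ t).2]
      · intro x hx
        simp only [Finset.coe_insert, Finset.coe_singleton, Set.mem_insert_iff,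
          Set.mem_singleton_iff] at hx
        rcases hx with rfl | rfl | rfl
        exacts [hmem _ (by simp), hmem _ (by simp), hplane t]
  -- The arc meets each circle through three of the other dots finitely often.
  have hmeet : {t | ∃ T : Finset E3, (T : Set E3) ⊆ B ∧ T.card = 3 ∧
      (γ t : E3) ∈ affineSpan ℝ (T : Set E3)}.Finite := by
    have : {t | ∃ T : Finset E3, (T : Set E3) ⊆ B ∧ T.card = 3 ∧
        (γ t : E3) ∈ affineSpan ℝ (T : Set E3)} ⊆
        ⋃ T ∈ {T : Finset E3 | (T : Set E3) ⊆ B},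
          {t | T.card = 3 ∧ (γ t : E3) ∈ affineSpan ℝ (T : Set E3)} := by
      rintro t ⟨T, hT, ht⟩
      exact Set.mem_biUnion hT ht
    refine ((finite_finset_subset hBfin).biUnion fun T hT => ?_).subset this
    -- Three meeting times would make the plane of `T` equal to that of the arc, hence put `p` on
    -- the circle through `T`.
    by_contra hinf
    obtain ⟨S, hS, hS3⟩ := Set.Infinite.exists_subset_card_eq hinf 3
    obtain ⟨s, hs⟩ : S.Nonempty := Finset.card_pos.1 (by omega)
    have hT3 : T.card = 3 := (hS hs).1
    let e : unitInterval ↪ E3 := ⟨fun t => γ t, Subtype.val_injective.comp hinj⟩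
    have hS' {P : Set E3} (hP : ∀ t ∈ S, (γ t : E3) ∈ P) : ((S.map e : Finset E3) : Set E3) ⊆ P := by
      intro x hx
      obtain ⟨t, ht, rfl⟩ := Finset.mem_map.1 hx
      exact hP t ht
    have hSs := hS' (P := Metric.sphere c r) fun t _ => (γ t).2
    have hSc : (S.map e).card = 3 := by rw [Finset.card_map, hS3]
    have e1 := affineSpan_eq_of_card_eq_three hSs hSc
      (finrank_direction_affineSpan_le_two hT3.le) (hS' fun t ht => (hS ht).2)
    have e2 := affineSpan_eq_of_card_eq_three hSs hSc hfr (hS' fun t _ => hplane t)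
    refine hD.notMem_affineSpan (Set.insert_subset p.2 hBs) (hT.trans (Set.subset_insert _ _)) hT3
      (Set.mem_insert _ _) (fun hpT => hpB (hT hpT)) ?_
    rw [← e1, e2]
    exact hmem _ (Finset.mem_insert_of_mem (Finset.mem_insert_self _ _))
  have hne (t) (j) (hj : j ≠ i) : D.1 j ≠ γ t := fun e =>
    havoid t (Or.inl ⟨j, hj, congrArg Subtype.val e⟩)
  let Γ : unitInterval → LConf c r n := fun t => ⟨Function.update D.1 i (γ t), by
    intro j k hjk
    by_cases hj : j = i
    · subst hj
      rw [Function.update_self, Function.update_of_ne hjk.symm]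
      exact (hne t k hjk.symm).symm
    · rw [Function.update_of_ne hj]
      by_cases hk : k = i
      · subst hk
        rw [Function.update_self]
        exact hne t j hj
      · rw [Function.update_of_ne hk]
        exact D.2 j k hjk⟩
  have hΓ : Continuous Γ :=
    Continuous.subtype_mk (continuous_const.update i γ.continuous) _
  have hdots (t) : (Γ t).dots = insert (γ t : E3) B := by
    rw [D.dots_eq_insert (Γ t) i fun j hj => Function.update_of_ne hj _ _]
    simp [Γ, hBdef]
  refine ⟨⟨⟨Γ, hΓ⟩, ?_, ?_⟩, hmeet.subset fun t ht => ?_, fun t => ?_⟩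
  · refine Subtype.ext (funext fun j => ?_)
    by_cases hj : j = i
    · subst hj; simp [Γ, hp]
    · simp [Γ, hj]
  · refine Subtype.ext (funext fun j => ?_)
    by_cases hj : j = i
    · subst hj; simp [Γ, hq]
    · simp [Γ, hj, h j hj]
  · by_contra hno
    refine ht ?_
    show GeneralPosition (Γ t).dots
    rw [hdots]
    exact hB.insert hBs (γ t).2 fun T hT h3 hmemT => hno ⟨T, hT, h3, hmemT⟩
  · show SemigeneralPosition (Γ t).dots
    rw [hdots]
    exact hB.semigeneralPosition_insert hBs (γ t).2 fun hF => havoid t (Or.inr hF)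

/-! ### Passage through a generic intermediate configuration -/

/-- Any finite number of generic dots can be added to two sets of dots in general position. -/
theorem exists_generic_family (hr : 0 < r) {A A' : Set E3} (hA : GeneralPosition A)
    (hA' : GeneralPosition A') (hs : A ⊆ Metric.sphere c r) (hs' : A' ⊆ Metric.sphere c r)
    (hfin : A.Finite) (hfin' : A'.Finite) (m : ℕ) :
    ∃ y : Fin m → Metric.sphere c r, Function.Injective y ∧
      (∀ i, (y i : E3) ∉ A ∪ A') ∧ GeneralPosition (A ∪ Set.range fun i => (y i : E3)) ∧
      GeneralPosition (A' ∪ Set.range fun i => (y i : E3)) := by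
  induction m with
  | zero => exact ⟨Fin.elim0, fun i => i.elim0, fun i => i.elim0, by simpa using hA,
      by simpa using hA'⟩
  | succ m ih =>
    obtain ⟨y, hy, hd, h1, h2⟩ := ih
    set R := Set.range fun i => (y i : E3)
    have hR : R ⊆ Metric.sphere c r := by rintro _ ⟨i, rfl⟩; exact (y i).2
    -- Genericity with respect to the whole union lets one `o` serve both sets.
    obtain ⟨o, ho, hgen⟩ := exists_generic c hr (A := (A ∪ A') ∪ R)
      ((hfin.union hfin').union (Set.finite_range _))
    have hoA := notMem_of_generic hgen
    have hrange : (Set.range fun i => ((Fin.cons ⟨o, ho⟩ y : Fin (m + 1) → Metric.sphere c r) i : E3))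
        = insert o R := by
      ext x
      simp [R, Fin.exists_fin_succ, eq_comm]
    refine ⟨Fin.cons ⟨o, ho⟩ y, ?_, ?_, ?_, ?_⟩
    · refine Fin.cons_injective_iff.2 ⟨?_, hy⟩
      rintro ⟨i, hi⟩
      exact hoA (Or.inr ⟨i, congrArg Subtype.val hi⟩)
    · refine Fin.cases ?_ fun i => ?_
      · exact fun h => hoA (Or.inl h)
      · simpa using hd i
    · rw [hrange, Set.union_insert]
      exact h1.insert (Set.union_subset hs hR) ho fun T hT h3 =>
        hgen T (hT.trans (Set.union_subset_union_left _ Set.subset_union_left)) h3.le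
    · rw [hrange, Set.union_insert]
      exact h2.insert (Set.union_subset hs' hR) ho fun T hT h3 =>
        hgen T (hT.trans (Set.union_subset_union_left _ Set.subset_union_right)) h3.le

/-- Disjoint configurations whose union is in general position are joined. -/
theorem goodJoined_of_union (hr : 0 < r) (D Y : LConf c r n)
    (hne : ∀ i j, D.1 i ≠ Y.1 j) (h : GeneralPosition (D.dots ∪ Y.dots)) : GoodJoined D Y := by
  classical
  -- Dots with label in `s` are already moved to `Y`. Every mixture lies in `D.dots ∪ Y.dots`, so it
  -- inherits general position.
  let mix : Finset (Fin n) → LConf c r n := fun s => ⟨s.piecewise Y.1 D.1, by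
    intro i j hij
    by_cases hi : i ∈ s <;> by_cases hj : j ∈ s <;> simp only [Finset.piecewise, hi, hj, if_true,
      if_false]
    exacts [Y.2 i j hij, (hne j i).symm, hne i j, D.2 i j hij]⟩
  have hmix (s) : GeneralPosition (mix s).dots := by
    refine h.mono ?_
    rintro _ ⟨i, rfl⟩
    by_cases hi : i ∈ s
    · exact Or.inr ⟨i, by simp [mix, hi]⟩
    · exact Or.inl ⟨i, by simp [mix, hi]⟩
  have key (s) : GoodJoined D (mix s) := by
    induction s using Finset.induction_on with
    | empty =>
      have : mix ∅ = D := Subtype.ext (by simp [mix])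
      rw [this]
      exact GoodJoined.refl (h.mono Set.subset_union_left)
    | insert i s _ ih =>
      refine ih.trans (goodJoined_of_forall_ne hr _ _ i (fun j hj => ?_) (hmix _) (hmix _))
      simp [mix, Finset.piecewise, hj]
  have : mix Finset.univ = Y := Subtype.ext (by simp [mix])
  exact this ▸ key Finset.univ

/-- Mixtures of `D` and `D'` themselves may have coinciding dots or cocircular quadruples, whence
the detour through `Y`. -/
theorem goodJoined (hr : 0 < r) {D D' : LConf c r n} (hD : GeneralPosition D.dots)
    (hD' : GeneralPosition D'.dots) : GoodJoined D D' := by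
  obtain ⟨y, hy, hd, h1, h2⟩ := exists_generic_family hr hD hD' D.dots_subset_sphere
    D'.dots_subset_sphere D.finite_dots D'.finite_dots n
  let Y : LConf c r n := ⟨y, fun i j hij => hy.ne hij⟩
  refine (goodJoined_of_union hr D Y (fun i j e => ?_) h1).trans
    (goodJoined_of_union hr D' Y (fun i j e => ?_) h2).symm
  · exact hd j (Or.inl ⟨i, congrArg Subtype.val e⟩)
  · exact hd j (Or.inr ⟨i, congrArg Subtype.val e⟩)

end

end Dots

theorem mainTheorem6 (c : Dots.E3) (r : ℝ) (hr : 0 < r) (n : ℕ) :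
    (∀ D D' : Dots.LConf c r n,
      Dots.GeneralPosition (Dots.LConf.dots D) → Dots.GeneralPosition (Dots.LConf.dots D') →
      ∃ γ : Path D D',
        {t : unitInterval | ¬ Dots.GeneralPosition (Dots.LConf.dots (γ t))}.Finite ∧
        ∀ t : unitInterval, Dots.SemigeneralPosition (Dots.LConf.dots (γ t))) ∧
    (∀ D D' : Dots.Conf c r n,
      Dots.GeneralPosition (Dots.Conf.dots D) → Dots.GeneralPosition (Dots.Conf.dots D') →
      ∃ γ : Path D D',
        {t : unitInterval | ¬ Dots.GeneralPosition (Dots.Conf.dots (γ t))}.Finite ∧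
        ∀ t : unitInterval, Dots.SemigeneralPosition (Dots.Conf.dots (γ t))) := by
  refine ⟨fun D D' hD hD' => Dots.goodJoined hr hD hD', fun D D' hD hD' => ?_⟩
  induction D using Quotient.inductionOn with | _ D
  induction D' using Quotient.inductionOn with | _ D'
  obtain ⟨γ, h1, h2⟩ := Dots.goodJoined hr (D := D) (D' := D') hD hD'
  -- The dots of a class are by definition those of a representative, so both conditions pass to the
  -- projected path.
  exact ⟨γ.map continuous_quotient_mk', h1, h2⟩
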